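/- Let $d\ge 2$. For $k\in\mathbb R^d$ let $|k|$ be the Euclidean norm, $\omega(k)=\omega_k=\sqrt{|k|}$, and for $x,y\in\mathbb R^d$ let $f_\pm(x,y)=x\cdot y\pm|x||y|$. With $\omega_i=\omega(k_i)$ define $$\begin{aligned} \tilde T_{k_1k_2}^{k_3k_4}=-\frac{1}{16\pi^2(|k_1||k_2||k_3||k_4|)^{1/4}}\Big\{&-12|k_1||k_2||k_3||k_4|\\ &-2(\omega_1+\omega_2)^2\big[\omega_3\omega_4f_-(k_1,k_2)+\omega_1\omega_2f_-(k_3,k_4)\big]\\ &-2(\omega_1-\omega_3)^2\big[\omega_2\omega_4f_+(k_1,k_3)+\omega_1\omega_3f_+(k_2,k_4)\big]\\ &-2(\omega_1-\omega_4)^2\big[\omega_2\omega_3f_+(k_1,k_4)+\omega_1\omega_4f_+(k_2,k_3)\big]\\ &+f_+(k_1,k_2)f_+(k_3,k_4)+f_-(k_1,k_3)f_-(k_2,k_4)+f_-(k_1,k_4)f_-(k_2,k_3)\\ &+\frac{4(\omega_1+\omega_2)^2f_-(k_1,k_2)f_-(k_3,k_4)}{\omega_{k_1+k_2}^2-(\omega_1+\omega_2)^2}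 +\frac{4(\omega_1-\omega_3)^2f_+(k_1,k_3)f_+(k_2,k_4)}{\omega_{k_1-k_3}^2-(\omega_1-\omega_3)^2}\\ &+\frac{4(\omega_1-\omega_4)^2f_+(k_1,k_4)f_+(k_2,k_3)}{\omega_{k_1-k_4}^2-(\omega_1-\omega_4)^2}\Big\}, \end{aligned}$$ where a quotient whose denominator vanishes is read as $0$. Define the amplitude $$T_{k_1k}^{k_2k_3}=\tfrac14\big(\tilde T_{k_1k}^{k_2k_3}+\tilde T_{kk_1}^{k_2k_3}+\tilde T_{k_2k_3}^{k_1k}+\tilde T_{k_3k_2}^{k_1k}\big)$$ and the collision kernel $T_{k,k_1,k_2,k_3}=|T_{k_1k}^{k_2k_3}|^2$. Then there is a constant $C_Q>0$ such that for all $k=k_0,k_1,k_2,k_3\in\mathbb R^d$ on the resonant manifold $$k+k_1-k_2-k_3=0,\qquad \omega(k)+\omega(k_1)-\omega(k_2)-\omega(k_3)=0$$ one has $$T_{k,k_1,k_2,k_3}\le C_Q\Big(\min_{0\le j<l\le 3}\big(|k_j|^2+|k_l|^2\big)\Big)^2\sum_{j=0}^3|k_j|^2 .$$ In particular, in the non-local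 regime $20|k_1|\le|k_3|$, $20|k_2|\le|k_3|$ of the resonant manifold, $$|T_{k_1k}^{k_2k_3}|\le C_Q\,(|k_1|^2+|k_2|^2)\,|k|\qquad\text{and}\qquad T_{k,k_1,k_2,k_3}\le C_Q\,(|k_1|^2+|k_2|^2)^2\,|k||k_3| .$$ -/

import Mathlib

/-- Wave vectors: `ℝᵈ` with its Euclidean norm. -/
abbrev WaveVec (d : ℕ) : Type := EuclideanSpace ℝ (Fin d)

namespace GravityWave

noncomputable section

variable {d : ℕ}

/-- The dispersion relation `ω(k) = √|k|` (gravitational acceleration `g = 1`). -/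
def omega (k : WaveVec d) : ℝ := Real.sqrt ‖k‖

/-- `f₊(x, y) = x · y + |x| |y|`. -/
def fPlus (x y : WaveVec d) : ℝ := inner ℝ x y + ‖x‖ * ‖y‖

/-- `f₋(x, y) = x · y - |x| |y|`. -/
def fMinus (x y : WaveVec d) : ℝ := inner ℝ x y - ‖x‖ * ‖y‖

/-- The pre-symmetrized interaction coefficient `T̃_{k₁ k₂}^{k₃ k₄}`; the first two arguments are
the lower indices, the last two the upper ones. A quotient with denominator zero is read as `0`.
For nonzero arguments this happens only in the last two fractions, when `k₁ = k₃` or `k₁ = k₄`,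
where `0` is the limit of the fraction. -/
def preT (k₁ k₂ k₃ k₄ : WaveVec d) : ℝ :=
  -(1 / (16 * Real.pi ^ 2 * (‖k₁‖ * ‖k₂‖ * ‖k₃‖ * ‖k₄‖) ^ (1 / 4 : ℝ))) *
    (-12 * ‖k₁‖ * ‖k₂‖ * ‖k₃‖ * ‖k₄‖
      - 2 * (omega k₁ + omega k₂) ^ 2 *
          (omega k₃ * omega k₄ * fMinus k₁ k₂ + omega k₁ * omega k₂ * fMinus k₃ k₄)
      - 2 * (omega k₁ - omega k₃) ^ 2 *
          (omega k₂ * omega k₄ * fPlus k₁ k₃ + omega k₁ * omega k₃ * fPlus k₂ k₄)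
      - 2 * (omega k₁ - omega k₄) ^ 2 *
          (omega k₂ * omega k₃ * fPlus k₁ k₄ + omega k₁ * omega k₄ * fPlus k₂ k₃)
      + fPlus k₁ k₂ * fPlus k₃ k₄ + fMinus k₁ k₃ * fMinus k₂ k₄ + fMinus k₁ k₄ * fMinus k₂ k₃
      + 4 * (omega k₁ + omega k₂) ^ 2 * fMinus k₁ k₂ * fMinus k₃ k₄ /
          (omega (k₁ + k₂) ^ 2 - (omega k₁ + omega k₂) ^ 2)
      + 4 * (omega k₁ - omega k₃) ^ 2 * fPlus k₁ k₃ * fPlus k₂ k₄ /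
          (omega (k₁ - k₃) ^ 2 - (omega k₁ - omega k₃) ^ 2)
      + 4 * (omega k₁ - omega k₄) ^ 2 * fPlus k₁ k₄ * fPlus k₂ k₃ /
          (omega (k₁ - k₄) ^ 2 - (omega k₁ - omega k₄) ^ 2))

/-- The symmetrized amplitude `T_{k₁ k}^{k₂ k₃}`; argument order `k₁, k, k₂, k₃`. -/
def amplitude (k₁ k k₂ k₃ : WaveVec d) : ℝ :=
  (1 / 4) * (preT k₁ k k₂ k₃ + preT k k₁ k₂ k₃ + preT k₂ k₃ k₁ k + preT k₃ k₂ k₁ k)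

/-- The collision kernel `T_{k,k₁,k₂,k₃} = |T_{k₁ k}^{k₂ k₃}|²`. -/
def kernel (k k₁ k₂ k₃ : WaveVec d) : ℝ := |amplitude k₁ k k₂ k₃| ^ 2

/-- The resonant manifold `Σ = 0`, `Ω = 0`, for the quadruple `(k, k₁, k₂, k₃)`, `k = K 0`. -/
def Resonant (K : Fin 4 → WaveVec d) : Prop :=
  K 0 + K 1 - K 2 - K 3 = 0 ∧ omega (K 0) + omega (K 1) - omega (K 2) - omega (K 3) = 0

/-- `min_{0 ≤ j < l ≤ 3} (|k_j|² + |k_l|²)`. -/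
def minPair (K : Fin 4 → WaveVec d) : ℝ :=
  ((Finset.univ : Finset (Fin 4 × Fin 4)).filter (fun p => p.1 < p.2)).inf'
    ⟨(0, 1), by decide⟩ (fun p => ‖K p.1‖ ^ 2 + ‖K p.2‖ ^ 2)

end

end GravityWave

namespace GravityWave

/-- The part of the brace of `preT` in which individual terms are larger than the sum, as a function
of the four frequencies, of `f₋` on the pairs `(k₁, k₂)`, `(k₃, k₄)`, of `f₊` on `(k₁, k₄)`,
`(k₂, k₃)`, and of the two denominators. -/
noncomputable def cancellingPart (a b u v f₁ f₂ g₁ g₂ D₁ D₂ : ℝ) : ℝ :=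
  -12 * a ^ 2 * b ^ 2 * u ^ 2 * v ^ 2
    - 2 * (a + u) ^ 2 * (b * v * f₁ + a * u * f₂) - 2 * (a - v) ^ 2 * (u * b * g₁ + a * v * g₂)
    + (f₁ + 2 * a ^ 2 * u ^ 2) * (f₂ + 2 * b ^ 2 * v ^ 2)
    + (g₁ - 2 * a ^ 2 * v ^ 2) * (g₂ - 2 * b ^ 2 * u ^ 2)
    + 4 * (a + u) ^ 2 * f₁ * f₂ / D₁ + 4 * (a - v) ^ 2 * g₁ * g₂ / D₂

theorem cancellingPart_smul {a b u v f₁ f₂ g₁ g₂ D₁ D₂ r : ℝ} (hr : r ≠ 0) (h₁ : D₁ ≠ 0)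
    (h₂ : D₂ ≠ 0) :
    cancellingPart (r * a) (r * b) (r * u) (r * v) (r ^ 4 * f₁) (r ^ 4 * f₂) (r ^ 4 * g₁)
      (r ^ 4 * g₂) (r ^ 2 * D₁) (r ^ 2 * D₂) = r ^ 8 * cancellingPart a b u v f₁ f₂ g₁ g₂ D₁ D₂ := by
  unfold cancellingPart
  field_simp

/-- The quotient by the sixth power of the small frequency in `exists_continuous_quotient`. -/
noncomputable def nonlocalQuotient (z t A h : ℝ) : ℝ :=
  -32 + h * 16 + A * (64 - h * 16 + A * (-48 + A * 16)) + t * (-64 + h * 16 + A * (96 - A *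
    48) + t * (-32 + A * 32)) + z * (32 + A * (-80 + h * 8 + A * (80 - h * 4 + A * (-40 + A *
    10))) + t * (32 + A * (-96 + A * (96 - A * 32)) + t * (16 + A * (-48 + A * 24))) + z * (h
    * (-48 + h * 8) + A * (h * 64 + A * (h * (-24))) + t * (-32 + A * (80 - h * 8 + A * (-80 +
    A * 40)) + t * (-176 + h * 48 + A * (272 - A * 144) + t * (-112 + A * 112))) + z * (h *
    (48 - h * 4) + A * (h * (-104 + h * 4) + A * (-8 + h * 72 + A * (8 - h * 20 - A * 2))) + t
    * (64 + h * 48 + A * (-144 - h * 72 + A * (136 + h * 36 + A * (-72 + A * 20))) + t * (128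
    + h * 16 + A * (-296 - h * 24 + A * (268 - A * 80)) + t * (64 + A * (-160 + A * 72)))) + z
    * (h * (16 - h * 36) + A * (h * (-32 + h * 28) + A * (8 + h * 24 + A * (-16 - h * 8 + A *
    (10 - A * 2)))) + t * (h * (-48) + A * (-32 + h * 48 + A * (48 - h * 24 + A * (-32 + A *
    8))) + t * (32 - h * 40 + A * (-16 + h * 24 + A * (-40 + A * 40)) + t * (-176 + h * 64 + A
    * (336 - A * 188) + t * (-176 + A * 176)))) + z * (h * (-16 + h * 32) + A * (h * (56 - h *
    42) + A * (8 + h * (-60 + h * 15) + A * (-12 + h * 28 + A * (8 - h * 6 + A * (-3 + A * (1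
    / 2)))))) + t * (h * (64 + h * 4) + A * (h * (-120 - h * 4) + A * (8 + h * 72 + A * (-24 -
    h * 20 + A * (18 - A * 4)))) + t * (48 + h * 112 + A * (-160 - h * 204 + A * (176 + h * 88
    + A * (-108 + A * 30))) + t * (240 + h * 56 + A * (-464 - h * 72 + A * (368 - A * 104)) +
    t * (128 + A * (-248 + A * 104))))) + z * (h * (h * (24 - h * 10)) + A * (h * (-16 - h *
    32) + A * (h * (36 + h * 12) + A * (h * (-24) + A * (h * 5)))) + t * (h * (32 - h * 36) +
    A * (16 + h * (-72 + h * 34) + A * (h * 72 + A * (-12 - h * 28 + A * (6 - A * 1)))) + t *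
    (-16 + h * (16 - h * 24) + A * (16 - h * 48 + A * (h * 12 + A * (-16 + A * 8))) + t * (16
    - h * 72 + A * (-32 + h * 28 + A * (-16 + A * 20)) + t * (-16 + h * 48 + A * (176 - A *
    136) + t * (-160 + A * 160))))) + z * (h * (h * (-28 + h * 8)) + A * (h * (h * (60 - h *
    5)) + A * (h * (h * (-42)) + A * (h * (-2 + h * 12) + A * (h * 4 + A * (h * (-3 / 2))))))
    + t * (h * (-32 + h * 32) + A * (h * (72 - h * 24) + A * (h * (-36) + A * (h * (-4) + A *
    (h * 4)))) + t * (h * (48 + h * 24) + A * (40 + h * (-80 - h * 8) + A * (-4 + h * 72 + A *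
    (-24 - h * 30 + A * (12 - A * 2)))) + t * (-16 + h * 144 + A * (-40 - h * 264 + A * (84 +
    h * 112 + A * (-64 + A * 20))) + t * (160 + h * 72 + A * (-328 - h * 104 + A * (248 - A *
    76)) + t * (176 + A * (-256 + A * 88)))))) + z * (h * (h * (4 + h * 16)) + A * (h * (h *
    (-20 - h * 12)) + A * (h * (h * 18) + A * (h * (h * (-4))))) + t * (h * (h * (32 - h *
    10)) + A * (h * (-8 - h * 48) + A * (h * (12 + h * 24) + A * (A * (h * (-1))))) + t * (h *
    (-24) + A * (h * (40 + h * 8) + A * (A * (h * (-12)))) + t * (-16 + h * (24 - h * 32) + A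
    * (88 - h * 24 + A * (-40 + h * 12 + A * (-8 + A * 4))) + t * (-64 - h * 56 + A * (56 + h
    * 16 + A * (-20 + A * 8)) + t * (48 + h * 16 + A * (40 - A * 72) + t * (-80 + A * 80))))))
    + z * (h * (h * (h * (-16))) + A * (h * (h * (2 + h * 20)) + A * (h * (h * (-3 - h * 8)) +
    A * (h * (h * (-3)) + A * (h * (h * (5 / 2)))))) + t * (h * (h * (-36 + h * 8)) + A * (h *
    (h * 52) + A * (h * (h * (-18)))) + t * (h * (-16 + h * 16) + A * (h * 12 + A * (h * 16 +
    A * (h * (-8) + A * (h * 2)))) + t * (h * (-16 + h * 32) + A * (h * (12 - h * 8) + A * (h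
    * 24 + A * (h * (-20)))) + t * (-32 + h * 96 + A * (88 - h * 156 + A * (-28 + h * 80 + A *
    (-14 + A * 5))) + t * (-16 + h * 64 + A * (-48 - h * 88 + A * (76 - A * 28)) + t * (128 +
    A * (-160 + A * 40))))))) + z * (h * (h * (h * (2 + h * 4))) + A * (h * (h * (h * (-4))) +
    A * (h * (h * h))) + t * (h * (h * (4 + h * 16)) + A * (h * (h * (-10 - h * 16)) + A * (h
    * (h * (-6)) + A * (h * (h * 5)))) + t * (h * (h * (-8)) + A * (h * (h * 8)) + t * (h *
    (-40 + h * 16) + A * (h * (40 + h * 8) + A * (h * 8 + A * (h * (-4)))) + t * (h * (-32 - h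
    * 24) + A * (h * 32 + A * (h * (-6))) + t * (-48 - h * 24 + A * (88 + h * 24 + A * (-36 +
    A * 2)) + t * (-16 + A * (40 - A * 28) + t * (-16 + A * 16))))))) + z * (h * (h * (h * (h
    * (-3)))) + A * (h * (h * (h * (1 + h * 2))) + A * (h * (h * (h * 2)) + A * (h * (h * (h *
    (-5 / 2)))))) + t * (h * (h * (h * (-16))) + A * (h * (h * (h * 12))) + t * (h * (h *
    (-8)) + A * (h * (h * (-8))) + t * (A * (h * (h * 8)) + t * (h * (-48 + h * 32) + A * (h *
    (44 - h * 4) + A * (h * 8 + A * (h * (-5)))) + t * (A * (h * (-32) + A * (h * 28)) + t *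
    (-32 + h * 40 + A * (40 - h * 40 + A * (-4 - A * 4)) + t * (32 + A * (-40 + A * 8))))))))
    + z * (h * (h * (h * (h * (-1)))) + A * (h * (h * (h * h))) + t * (h * (h * (h * (2 + h *
    4))) + A * (h * (h * (h * 4)) + A * (h * (h * (h * (-5))))) + t * (t * (h * (h * (-16)) +
    A * (h * (h * (-8))) + t * (h * (h * 8) + A * (h * (h * 8)) + t * (h * (-40 - h * 8) + A *
    (h * 40 + A * (h * (-2))) + t * (h * (-24) + A * (h * 20) + t * (-16 + A * (24 - A *
    8)))))))) + z * (A * (h * (h * (h * (h * (-1 / 2)))) + A * (h * (h * (h * (h * (5 /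
    4)))))) + t * (h * (h * (h * (h * (-3)))) + t * (t * (t * (h * (h * (-16)) + A * (h * (h *
    (-4))) + t * (h * (h * 16) + t * (h * (-16) + A * (h * 12 + A * (h * 4)) + t * (h * 8 + A
    * (h * (-8))))))))) + z * (h * (h * (h * (h * (h * (-1 / 2))))) + t * (h * (h * (h * (h *
    (-1)))) + A * (h * (h * (h * (h * (5 / 2))))) + t * (t * (t * (t * (h * (h * (-8)) + t *
    (t * (h * (-8) + A * (h * 8)))))))) + z * (A * (h * (h * (h * (h * (h * (-1 / 4)))))) + z
    * (t * (h * (h * (h * (h * (h * (-1 / 2))))))))))))))))))))))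

set_option maxHeartbeats 2000000 in
/-- The cancellation behind the non-local bound: with the frequencies `z, z + t z², 1 + t z², 1`
the numerator of the cancelling part vanishes to sixth order in `z`. -/
theorem exists_continuous_quotient :
    ∃ G : ℝ × ℝ × ℝ × ℝ → ℝ, Continuous G ∧ ∀ z t A h b u m₁ m₂ n₁ n₂ X Y : ℝ,
      b = z + t * z ^ 2 → u = 1 + t * z ^ 2 →
      m₁ = -(A * (2 * (z ^ 2 + u ^ 2) - A * z ^ 2)) / 2 →
      m₂ = -((A - 2 * t * (1 - z)) * (2 * (b ^ 2 + 1) - (A - 2 * t * (1 - z)) * z ^ 2)) / 2 →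
      n₁ = (2 - A + h * z ^ 2) * (2 * (z ^ 2 + 1) - (2 - A + h * z ^ 2) * z ^ 2) / 2 →
      n₂ = (2 - A + h * z ^ 2 + 2 * t * (b + 1)) *
        (2 * (u ^ 2 + b ^ 2) - (2 - A + h * z ^ 2 + 2 * t * (b + 1)) * z ^ 2) / 2 →
      X = 2 * u + A * z → Y = 2 - (2 - A + h * z ^ 2) * z →
      (-12 * z ^ 2 * b ^ 2 * u ^ 2 - 2 * (z + u) ^ 2 * (b * (z ^ 2 * m₁) + z * u * (z ^ 2 * m₂))
        - 2 * (z - 1) ^ 2 * (u * b * (z ^ 2 * n₁) + z * (z ^ 2 * n₂))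
        + (z ^ 2 * m₁ + 2 * z ^ 2 * u ^ 2) * (z ^ 2 * m₂ + 2 * b ^ 2)
        + (z ^ 2 * n₁ - 2 * z ^ 2) * (z ^ 2 * n₂ - 2 * b ^ 2 * u ^ 2)) * (z * X * Y)
        - 4 * (z + u) ^ 2 * (z ^ 2 * m₁) * (z ^ 2 * m₂) * Y
        + 4 * (z - 1) ^ 2 * (z ^ 2 * n₁) * (z ^ 2 * n₂) * X = z ^ 6 * G (z, t, A, h) := by
  refine ⟨fun p => nonlocalQuotient p.1 p.2.1 p.2.2.1 p.2.2.2, by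
    unfold nonlocalQuotient; fun_prop, ?_⟩
  rintro z t A h b u m₁ m₂ n₁ n₂ X Y rfl rfl rfl rfl rfl rfl rfl rfl
  unfold nonlocalQuotient
  ring

/-- Size of the cancelling part when the two small frequencies are `z` and `z + t z²` and the two
large ones are `1 + t z²` and `1`. -/
theorem exists_cancellingPart_le_unit (R : ℝ) :
    ∃ C : ℝ, 0 ≤ C ∧ ∀ z t A h b u m₁ m₂ n₁ n₂ X Y : ℝ,
      0 < z → z ≤ 1 → |t| ≤ R → |A| ≤ R → |h| ≤ R →
      b = z + t * z ^ 2 → u = 1 + t * z ^ 2 →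
      m₁ = -(A * (2 * (z ^ 2 + u ^ 2) - A * z ^ 2)) / 2 →
      m₂ = -((A - 2 * t * (1 - z)) * (2 * (b ^ 2 + 1) - (A - 2 * t * (1 - z)) * z ^ 2)) / 2 →
      n₁ = (2 - A + h * z ^ 2) * (2 * (z ^ 2 + 1) - (2 - A + h * z ^ 2) * z ^ 2) / 2 →
      n₂ = (2 - A + h * z ^ 2 + 2 * t * (b + 1)) *
        (2 * (u ^ 2 + b ^ 2) - (2 - A + h * z ^ 2 + 2 * t * (b + 1)) * z ^ 2) / 2 →
      X = 2 * u + A * z → Y = 2 - (2 - A + h * z ^ 2) * z → 1 ≤ X → 1 ≤ Y →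
      |cancellingPart z b u 1 (z ^ 2 * m₁) (z ^ 2 * m₂) (z ^ 2 * n₁) (z ^ 2 * n₂)
        (-(z * X)) (z * Y)| ≤ C * z ^ 5 := by
  obtain ⟨G, hG, hN⟩ := exists_continuous_quotient
  obtain ⟨C, hC⟩ := ((isCompact_Icc (a := (0 : ℝ)) (b := 1)).prod
    ((isCompact_Icc (a := -R) (b := R)).prod ((isCompact_Icc (a := -R) (b := R)).prod
      (isCompact_Icc (a := -R) (b := R))))).exists_bound_of_continuousOn hG.continuousOn
  refine ⟨max C 0, le_max_right _ _, ?_⟩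
  intro z t A h b u m₁ m₂ n₁ n₂ X Y hz hz1 ht hA hh hb hu hm₁ hm₂ hn₁ hn₂ hX hY hX1 hY1
  have hGC : |G (z, t, A, h)| ≤ max C 0 :=
    (hC (z, t, A, h) ⟨⟨hz.le, hz1⟩, abs_le.1 ht, abs_le.1 hA, abs_le.1 hh⟩).trans (le_max_left _ _)
  have hX0 : 0 < X := by linarith
  have hY0 : 0 < Y := by linarith
  have key : cancellingPart z b u 1 (z ^ 2 * m₁) (z ^ 2 * m₂) (z ^ 2 * n₁) (z ^ 2 * n₂)
      (-(z * X)) (z * Y) = z ^ 5 * G (z, t, A, h) / (X * Y) := by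
    have h6 := hN z t A h b u m₁ m₂ n₁ n₂ X Y hb hu hm₁ hm₂ hn₁ hn₂ hX hY
    have h5 : z ^ 5 * G (z, t, A, h) / (X * Y) = z ^ 6 * G (z, t, A, h) / (z * X * Y) := by
      field_simp
    rw [h5, ← h6]
    clear h6 h5 hm₁ hm₂ hn₁ hn₂ hX hY hb hu
    unfold cancellingPart
    field_simp
    ring
  rw [key, abs_div, abs_mul, abs_of_pos (by positivity : 0 < X * Y), abs_of_pos (pow_pos hz 5)]
  rw [div_le_iff₀ (by positivity)]
  have hXY : 1 ≤ X * Y := one_le_mul_of_one_le_of_one_le hX1 hY1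
  calc z ^ 5 * |G (z, t, A, h)| ≤ z ^ 5 * max C 0 := by gcongr
    _ = max C 0 * z ^ 5 * 1 := by ring
    _ ≤ max C 0 * z ^ 5 * (X * Y) := by gcongr

/-- Size of the cancelling part for two small frequencies `a, b` and two large ones `u, v`. -/
theorem exists_cancellingPart_le (R : ℝ) :
    ∃ C : ℝ, 0 ≤ C ∧ ∀ a b u v α γ : ℝ, 0 < a → a ≤ v → a + u = b + v →
      |b - a| * v ≤ R * a ^ 2 → |α| ≤ R * a ^ 2 → |α + γ - 2 * a ^ 2| * v ^ 2 ≤ R * a ^ 4 →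
      a * v ≤ 2 * a * u + α → a * v ≤ 2 * a * v - γ →
      |cancellingPart a b u v (-(α * (2 * (a ^ 2 + u ^ 2) - α)) / 2)
        (-((α - 2 * (b - a) * (v - a)) *
          (2 * (b ^ 2 + v ^ 2) - (α - 2 * (b - a) * (v - a)))) / 2)
        (γ * (2 * (a ^ 2 + v ^ 2) - γ) / 2)
        ((γ + 2 * (b - a) * (b + v)) *
          (2 * (u ^ 2 + b ^ 2) - (γ + 2 * (b - a) * (b + v))) / 2)
        (-(2 * a * u + α)) (2 * a * v - γ)| ≤ C * (a ^ 5 * v ^ 3) := by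
  obtain ⟨C, hC0, hC⟩ := exists_cancellingPart_le_unit R
  refine ⟨C, hC0, ?_⟩
  intro a b u v α γ ha hav hres hθ hα hη hX hY
  have hv : 0 < v := ha.trans_le hav
  obtain ⟨z, hz⟩ : ∃ z, z = a / v := ⟨_, rfl⟩
  obtain ⟨t, ht⟩ : ∃ t, t = (b - a) * v / a ^ 2 := ⟨_, rfl⟩
  obtain ⟨A, hA⟩ : ∃ A, A = α / a ^ 2 := ⟨_, rfl⟩
  obtain ⟨h, hh⟩ : ∃ h, h = (α + γ - 2 * a ^ 2) * v ^ 2 / a ^ 4 := ⟨_, rfl⟩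
  have hz0 : 0 < z := by rw [hz]; positivity
  have ea : a = v * z := by rw [hz]; field_simp
  have eb : b = v * (z + t * z ^ 2) := by rw [hz, ht]; field_simp; ring
  have eu : u = v * (1 + t * z ^ 2) := by linarith
  have eα : α = v ^ 2 * (A * z ^ 2) := by rw [hz, hA]; field_simp
  have eγ : γ = v ^ 2 * ((2 - A + h * z ^ 2) * z ^ 2) := by rw [hz, hA, hh]; field_simp; ring
  have bt : |t| ≤ R := by
    rw [ht, abs_div, abs_mul, abs_of_pos hv, abs_of_pos (by positivity : 0 < a ^ 2),
      div_le_iff₀ (by positivity)]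
    exact hθ
  have bA : |A| ≤ R := by
    rw [hA, abs_div, abs_of_pos (by positivity : 0 < a ^ 2), div_le_iff₀ (by positivity)]
    exact hα
  have bh : |h| ≤ R := by
    rw [hh, abs_div, abs_mul, abs_of_pos (by positivity : 0 < a ^ 4),
      abs_of_pos (by positivity : 0 < v ^ 2), div_le_iff₀ (by positivity)]
    exact hη
  clear hθ hα hη ht hA hh
  have hz1 : z ≤ 1 := by rw [hz, div_le_one hv]; exact hav
  have hX1 : 1 ≤ 2 * (1 + t * z ^ 2) + A * z := by
    have : 0 < v ^ 2 * z := by positivity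
    refine le_of_mul_le_mul_left ?_ this
    rw [ea, eu, eα] at hX
    linarith
  have hY1 : 1 ≤ 2 - (2 - A + h * z ^ 2) * z := by
    have : 0 < v ^ 2 * z := by positivity
    refine le_of_mul_le_mul_left ?_ this
    rw [ea, eγ] at hY
    linarith
  have hb := hC z t A h _ _ _ _ _ _ _ _ hz0 hz1 bt bA bh rfl rfl rfl rfl rfl rfl rfl rfl hX1 hY1
  have hs := cancellingPart_smul (a := z) (b := z + t * z ^ 2) (u := 1 + t * z ^ 2) (v := 1)
    (f₁ := z ^ 2 * (-(A * (2 * (z ^ 2 + (1 + t * z ^ 2) ^ 2) - A * z ^ 2)) / 2))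
    (f₂ := z ^ 2 * (-((A - 2 * t * (1 - z)) *
      (2 * ((z + t * z ^ 2) ^ 2 + 1) - (A - 2 * t * (1 - z)) * z ^ 2)) / 2))
    (g₁ := z ^ 2 * ((2 - A + h * z ^ 2) * (2 * (z ^ 2 + 1) - (2 - A + h * z ^ 2) * z ^ 2) / 2))
    (g₂ := z ^ 2 * ((2 - A + h * z ^ 2 + 2 * t * (z + t * z ^ 2 + 1)) *
      (2 * ((1 + t * z ^ 2) ^ 2 + (z + t * z ^ 2) ^ 2)
        - (2 - A + h * z ^ 2 + 2 * t * (z + t * z ^ 2 + 1)) * z ^ 2) / 2))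
    (D₁ := -(z * (2 * (1 + t * z ^ 2) + A * z))) (D₂ := z * (2 - (2 - A + h * z ^ 2) * z)) hv.ne'
    (neg_ne_zero.2 (mul_pos hz0 (by linarith)).ne') (mul_pos hz0 (by linarith)).ne'
  calc _ = |v ^ 8 * _| := by
        rw [← hs]
        congr 2
        · ring
        · rw [eα, ea, eu]; ring
        · rw [eα, ea, eb]; ring
        · rw [eγ, ea]; ring
        · rw [eγ, ea, eb, eu]; ring
        · rw [eα, ea, eu]; ring
        · rw [eγ, ea]; ring
    _ ≤ v ^ 8 * (C * z ^ 5) := by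
        rw [abs_mul, abs_of_pos (by positivity : 0 < v ^ 8)]
        gcongr
    _ = C * (a ^ 5 * v ^ 3) := by rw [ea]; ring

variable {d : ℕ}

theorem omega_nonneg (x : WaveVec d) : 0 ≤ omega x := Real.sqrt_nonneg _

theorem omega_sq (x : WaveVec d) : omega x ^ 2 = ‖x‖ := Real.sq_sqrt (norm_nonneg _)

theorem fPlus_comm (x y : WaveVec d) : fPlus x y = fPlus y x := by
  unfold fPlus; rw [real_inner_comm, mul_comm ‖x‖]

theorem fMinus_comm (x y : WaveVec d) : fMinus x y = fMinus y x := by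
  unfold fMinus; rw [real_inner_comm, mul_comm ‖x‖]

theorem fPlus_eq_fMinus_add (x y : WaveVec d) :
    fPlus x y = fMinus x y + 2 * omega x ^ 2 * omega y ^ 2 := by
  unfold fPlus fMinus; rw [omega_sq, omega_sq]; ring

theorem fMinus_eq (x y : WaveVec d) :
    fMinus x y = (‖x + y‖ ^ 2 - (omega x ^ 2 + omega y ^ 2) ^ 2) / 2 := by
  unfold fMinus; rw [omega_sq, omega_sq, norm_add_sq_real]; ring

theorem fPlus_eq (x y : WaveVec d) :
    fPlus x y = ((omega x ^ 2 + omega y ^ 2) ^ 2 - ‖x - y‖ ^ 2) / 2 := by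
  unfold fPlus; rw [omega_sq, omega_sq, norm_sub_sq_real]; ring

theorem fPlus_nonneg (x y : WaveVec d) : 0 ≤ fPlus x y := by
  unfold fPlus; linarith [neg_le_of_abs_le (abs_real_inner_le_norm x y)]

theorem fMinus_nonpos (x y : WaveVec d) : fMinus x y ≤ 0 := by
  unfold fMinus; linarith [le_of_abs_le (abs_real_inner_le_norm x y)]

theorem abs_fPlus_le (x y : WaveVec d) : |fPlus x y| ≤ 2 * omega x ^ 2 * omega y ^ 2 := by
  rw [abs_of_nonneg (fPlus_nonneg x y), fPlus_eq_fMinus_add]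
  linarith [fMinus_nonpos x y]

theorem abs_fMinus_le (x y : WaveVec d) : |fMinus x y| ≤ 2 * omega x ^ 2 * omega y ^ 2 := by
  rw [abs_of_nonpos (fMinus_nonpos x y)]
  linarith [fPlus_nonneg x y, fPlus_eq_fMinus_add x y]

theorem two_mul_omega_le_abs_denom (x y : WaveVec d) :
    2 * omega x * omega y ≤ |omega (x + y) ^ 2 - (omega x + omega y) ^ 2| := by
  rw [le_abs]; right
  have := norm_add_le x y
  rw [← omega_sq, ← omega_sq, ← omega_sq] at this
  linarith

theorem two_mul_abs_le_denom (x y : WaveVec d) :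
    2 * |omega x - omega y| * min (omega x) (omega y) ≤
      omega (x - y) ^ 2 - (omega x - omega y) ^ 2 := by
  have h1 := norm_sub_norm_le x y
  have h2 := norm_sub_norm_le y x
  rw [norm_sub_rev y x] at h2
  rw [← omega_sq, ← omega_sq, ← omega_sq] at h1 h2
  rcases le_total (omega x) (omega y) with h | h
  · rw [min_eq_left h, abs_of_nonpos (by linarith)]; nlinarith
  · rw [min_eq_right h, abs_of_nonneg (by linarith)]; nlinarith

/-- The fraction with `f₋` has a denominator that controls it. -/
theorem abs_fMinus_div_le (x y : WaveVec d) :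
    |fMinus x y / (omega (x + y) ^ 2 - (omega x + omega y) ^ 2)| ≤ omega x * omega y := by
  have hx := omega_nonneg x
  have hy := omega_nonneg y
  rw [abs_div]
  refine div_le_of_le_mul₀ (abs_nonneg _) (by positivity) ((abs_fMinus_le x y).trans ?_)
  calc 2 * omega x ^ 2 * omega y ^ 2 = omega x * omega y * (2 * omega x * omega y) := by ring
    _ ≤ _ := by gcongr; exact two_mul_omega_le_abs_denom x y

/-- The fraction with `f₊` stays bounded where its denominator vanishes. -/
theorem abs_fPlus_div_le {x y : WaveVec d} {W : ℝ} (hxW : omega x ≤ W) (hyW : omega y ≤ W) :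
    |(omega x - omega y) ^ 2 * fPlus x y / (omega (x - y) ^ 2 - (omega x - omega y) ^ 2)| ≤
      omega x * omega y * W ^ 2 := by
  have hx := omega_nonneg x
  have hy := omega_nonneg y
  have hW := hx.trans hxW
  have hd := two_mul_abs_le_denom x y
  have hmin : 0 ≤ min (omega x) (omega y) := le_min hx hy
  have hd0 : 0 ≤ omega (x - y) ^ 2 - (omega x - omega y) ^ 2 := le_trans (by positivity) hd
  have habs : |omega x - omega y| ≤ W := abs_sub_le_iff.2 ⟨by linarith, by linarith⟩
  have hmax : max (omega x) (omega y) ≤ W := max_le hxW hyW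
  rw [abs_div, abs_mul, abs_of_nonneg hd0, abs_of_nonneg (sq_nonneg _)]
  refine div_le_of_le_mul₀ hd0 (by positivity) ?_
  calc (omega x - omega y) ^ 2 * |fPlus x y|
      ≤ (omega x - omega y) ^ 2 * (2 * omega x ^ 2 * omega y ^ 2) := by
        gcongr; exact abs_fPlus_le x y
    _ = omega x * omega y * (|omega x - omega y| * max (omega x) (omega y)) *
          (2 * |omega x - omega y| * min (omega x) (omega y)) := by
        have h1 := max_mul_min (omega x) (omega y)
        have h2 := sq_abs (omega x - omega y)
        rw [← h2]
        linear_combination (-(2 * |omega x - omega y| ^ 2 * omega x * omega y)) * h1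
    _ ≤ omega x * omega y * (W * W) *
          (omega (x - y) ^ 2 - (omega x - omega y) ^ 2) := by
        gcongr
    _ = _ := by ring

/-- The expression in braces in the definition of `preT`. -/
noncomputable def brace (k₁ k₂ k₃ k₄ : WaveVec d) : ℝ :=
  -12 * ‖k₁‖ * ‖k₂‖ * ‖k₃‖ * ‖k₄‖
      - 2 * (omega k₁ + omega k₂) ^ 2 *
          (omega k₃ * omega k₄ * fMinus k₁ k₂ + omega k₁ * omega k₂ * fMinus k₃ k₄)
      - 2 * (omega k₁ - omega k₃) ^ 2 *
          (omega k₂ * omega k₄ * fPlus k₁ k₃ + omega k₁ * omega k₃ * fPlus k₂ k₄)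
      - 2 * (omega k₁ - omega k₄) ^ 2 *
          (omega k₂ * omega k₃ * fPlus k₁ k₄ + omega k₁ * omega k₄ * fPlus k₂ k₃)
      + fPlus k₁ k₂ * fPlus k₃ k₄ + fMinus k₁ k₃ * fMinus k₂ k₄ + fMinus k₁ k₄ * fMinus k₂ k₃
      + 4 * (omega k₁ + omega k₂) ^ 2 * fMinus k₁ k₂ * fMinus k₃ k₄ /
          (omega (k₁ + k₂) ^ 2 - (omega k₁ + omega k₂) ^ 2)
      + 4 * (omega k₁ - omega k₃) ^ 2 * fPlus k₁ k₃ * fPlus k₂ k₄ /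
          (omega (k₁ - k₃) ^ 2 - (omega k₁ - omega k₃) ^ 2)
      + 4 * (omega k₁ - omega k₄) ^ 2 * fPlus k₁ k₄ * fPlus k₂ k₃ /
          (omega (k₁ - k₄) ^ 2 - (omega k₁ - omega k₄) ^ 2)

theorem preT_eq (k₁ k₂ k₃ k₄ : WaveVec d) :
    preT k₁ k₂ k₃ k₄ = -(1 / (16 * Real.pi ^ 2 *
      √(omega k₁ * omega k₂ * omega k₃ * omega k₄))) * brace k₁ k₂ k₃ k₄ := by
  have h : (‖k₁‖ * ‖k₂‖ * ‖k₃‖ * ‖k₄‖) ^ (1 / 4 : ℝ) =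
      √(omega k₁ * omega k₂ * omega k₃ * omega k₄) := by
    have h0 : 0 ≤ omega k₁ * omega k₂ * omega k₃ * omega k₄ := by
      have := omega_nonneg k₁; have := omega_nonneg k₂
      have := omega_nonneg k₃; have := omega_nonneg k₄
      positivity
    rw [← omega_sq, ← omega_sq, ← omega_sq, ← omega_sq, ← mul_pow, ← mul_pow, ← mul_pow,
      ← Real.rpow_natCast, ← Real.rpow_mul h0, Real.sqrt_eq_rpow]
    norm_num
  unfold preT brace
  rw [h]

/-- A bound for `preT` in terms of a bound for the brace. -/
theorem abs_preT_le {k₁ k₂ k₃ k₄ : WaveVec d} {s : ℝ} (hs : 0 ≤ s)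
    (h : |brace k₁ k₂ k₃ k₄| ≤ s * √(omega k₁ * omega k₂ * omega k₃ * omega k₄)) :
    |preT k₁ k₂ k₃ k₄| ≤ s := by
  have hpi : 1 ≤ 16 * Real.pi ^ 2 := by nlinarith [Real.pi_gt_three]
  have hr := Real.sqrt_nonneg (omega k₁ * omega k₂ * omega k₃ * omega k₄)
  rw [preT_eq, abs_mul, abs_neg, abs_div, abs_one, abs_of_nonneg (by positivity),
    one_div_mul_eq_div]
  refine div_le_of_le_mul₀ (by positivity) hs (h.trans ?_)
  gcongr
  nlinarith

set_option maxHeartbeats 800000 in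
/-- The size of the brace, without any use of resonance. -/
theorem abs_brace_le {k₁ k₂ k₃ k₄ : WaveVec d} {W : ℝ} (h₁ : omega k₁ ≤ W) (h₂ : omega k₂ ≤ W)
    (h₃ : omega k₃ ≤ W) (h₄ : omega k₄ ≤ W) :
    |brace k₁ k₂ k₃ k₄| ≤ 120 * W ^ 4 * (omega k₁ * omega k₂ * omega k₃ * omega k₄) := by
  have q₁ := abs_fMinus_div_le k₁ k₂
  have q₂ := abs_fPlus_div_le h₁ h₃
  have q₃ := abs_fPlus_div_le h₁ h₄
  have m₁₂ := abs_fMinus_le k₁ k₂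
  have m₃₄ := abs_fMinus_le k₃ k₄
  have m₁₃ := abs_fMinus_le k₁ k₃
  have m₂₄ := abs_fMinus_le k₂ k₄
  have m₁₄ := abs_fMinus_le k₁ k₄
  have m₂₃ := abs_fMinus_le k₂ k₃
  have p₁₂ := abs_fPlus_le k₁ k₂
  have p₃₄ := abs_fPlus_le k₃ k₄
  have p₁₃ := abs_fPlus_le k₁ k₃
  have p₂₄ := abs_fPlus_le k₂ k₄
  have p₁₄ := abs_fPlus_le k₁ k₄
  have p₂₃ := abs_fPlus_le k₂ k₃
  unfold brace
  rw [← omega_sq k₁, ← omega_sq k₂, ← omega_sq k₃, ← omega_sq k₄]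
  have a0 := omega_nonneg k₁
  have u0 := omega_nonneg k₂
  have b0 := omega_nonneg k₃
  have v0 := omega_nonneg k₄
  rw [show ∀ s f g D : ℝ, 4 * s * f * g / D = 4 * s * g * (f / D) by intros; ring,
    show ∀ s f g D : ℝ, 4 * s * f * g / D = 4 * g * (s * f / D) by intros; ring,
    show ∀ s f g D : ℝ, 4 * s * f * g / D = 4 * g * (s * f / D) by intros; ring]
  generalize fMinus k₁ k₂ / _ = Q₁ at *
  generalize (omega k₁ - omega k₃) ^ 2 * fPlus k₁ k₃ / _ = Q₂ at *
  generalize (omega k₁ - omega k₄) ^ 2 * fPlus k₁ k₄ / _ = Q₃ at *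
  generalize omega k₁ = a at *
  generalize omega k₂ = u at *
  generalize omega k₃ = b at *
  generalize omega k₄ = v at *
  have hW := a0.trans h₁
  have hN : 0 ≤ a * u * b * v := by positivity
  have hpair : ∀ {x y : ℝ}, 0 ≤ y → x ≤ W → y ≤ W → x * y ≤ W ^ 2 := by
    intro x y hy hx hy'
    nlinarith
  have hau := hpair u0 h₁ h₂
  have hbv := hpair v0 h₃ h₄
  have hav := hpair v0 h₁ h₄
  have hub := hpair b0 h₂ h₃
  have hab := hpair b0 h₁ h₃
  have huv := hpair v0 h₂ h₄
  have hs₁ : |(a + u) ^ 2| ≤ 4 * W ^ 2 := by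
    rw [abs_of_nonneg (sq_nonneg _)]; nlinarith
  have hs₂ : |(a - b) ^ 2| ≤ W ^ 2 := by
    rw [abs_of_nonneg (sq_nonneg _)]; nlinarith
  have hs₃ : |(a - v) ^ 2| ≤ W ^ 2 := by
    rw [abs_of_nonneg (sq_nonneg _)]; nlinarith
  have hprod : (a * u) * (b * v) ≤ W ^ 2 * W ^ 2 := by gcongr
  have hNN : (a * u * b * v) * (a * u * b * v) ≤ W ^ 4 * (a * u * b * v) := by
    refine mul_le_mul_of_nonneg_right ?_ hN
    linarith
  have hlin : ∀ {S F G x y z w c : ℝ}, 0 ≤ x → 0 ≤ y → 0 ≤ z → 0 ≤ w → x * y ≤ W ^ 2 →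
      z * w ≤ W ^ 2 → x * y * (z * w) = a * u * b * v → 0 ≤ c →
      |S| ≤ c * W ^ 2 → |F| ≤ 2 * x ^ 2 * y ^ 2 → |G| ≤ 2 * z ^ 2 * w ^ 2 →
      |2 * S * (z * w * F + x * y * G)| ≤ 8 * c * W ^ 4 * (a * u * b * v) := by
    intro S F G x y z w c hx hy hz hw hxy hzw hxyzw hc hS hF hG
    rw [abs_mul, abs_mul, abs_two]
    have hsum : |z * w * F + x * y * G| ≤ 4 * W ^ 2 * (a * u * b * v) := by
      refine (abs_add_le _ _).trans ?_
      rw [abs_mul, abs_mul (x * y), abs_of_nonneg (by positivity : 0 ≤ z * w),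
        abs_of_nonneg (by positivity : 0 ≤ x * y), ← hxyzw]
      calc z * w * |F| + x * y * |G|
          ≤ z * w * (2 * x ^ 2 * y ^ 2) + x * y * (2 * z ^ 2 * w ^ 2) := by gcongr
        _ = 2 * (x * y * (z * w)) * (x * y) + 2 * (x * y * (z * w)) * (z * w) := by ring
        _ ≤ 2 * (x * y * (z * w)) * W ^ 2 + 2 * (x * y * (z * w)) * W ^ 2 := by gcongr
        _ = _ := by ring
    calc 2 * |S| * |z * w * F + x * y * G|
        ≤ 2 * (c * W ^ 2) * (4 * W ^ 2 * (a * u * b * v)) := by gcongr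
      _ = _ := by ring
  have hquad : ∀ {F G x y z w : ℝ}, x * y * (z * w) = a * u * b * v →
      |F| ≤ 2 * x ^ 2 * y ^ 2 → |G| ≤ 2 * z ^ 2 * w ^ 2 →
      |F * G| ≤ 4 * W ^ 4 * (a * u * b * v) := by
    intro F G x y z w hxyzw hF hG
    rw [abs_mul]
    calc |F| * |G| ≤ (2 * x ^ 2 * y ^ 2) * (2 * z ^ 2 * w ^ 2) := by gcongr
      _ = 4 * ((x * y * (z * w)) * (x * y * (z * w))) := by ring
      _ ≤ 4 * W ^ 4 * (a * u * b * v) := by rw [hxyzw]; linarith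
  have e₁ : |-12 * a ^ 2 * u ^ 2 * b ^ 2 * v ^ 2| ≤ 12 * W ^ 4 * (a * u * b * v) := by
    rw [show -12 * a ^ 2 * u ^ 2 * b ^ 2 * v ^ 2 = -(12 * (a ^ 2 * u ^ 2 * b ^ 2 * v ^ 2)) by ring,
      abs_neg, abs_of_nonneg (by positivity)]
    linarith
  have e₂ := hlin a0 u0 b0 v0 hau hbv (by ring) (by norm_num) hs₁ m₁₂ m₃₄
  have e₃ := hlin (S := (a - b) ^ 2) a0 b0 u0 v0 hab huv (by ring) zero_le_one (by rwa [one_mul]) p₁₃ p₂₄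
  have e₄ := hlin (S := (a - v) ^ 2) a0 v0 u0 b0 hav hub (by ring) zero_le_one (by rwa [one_mul]) p₁₄ p₂₃
  have e₅ := hquad (by ring) p₁₂ p₃₄
  have e₆ := hquad (by ring) m₁₃ m₂₄
  have e₇ := hquad (by ring) m₁₄ m₂₃
  have e₈ : |4 * (a + u) ^ 2 * fMinus k₃ k₄ * Q₁| ≤ 32 * W ^ 4 * (a * u * b * v) := by
    rw [abs_mul, abs_mul, abs_mul, abs_of_nonneg (by norm_num : (0 : ℝ) ≤ 4)]
    calc 4 * |(a + u) ^ 2| * |fMinus k₃ k₄| * |Q₁|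
        ≤ 4 * (4 * W ^ 2) * (2 * b ^ 2 * v ^ 2) * (a * u) := by gcongr
      _ = 32 * W ^ 2 * (a * u * b * v) * (b * v) := by ring
      _ ≤ 32 * W ^ 2 * (a * u * b * v) * W ^ 2 := by gcongr
      _ = _ := by ring
  have hQ : ∀ {F Q x y z w : ℝ}, 0 ≤ x → 0 ≤ y → z * w ≤ W ^ 2 → x * y * (z * w) = a * u * b * v →
      |F| ≤ 2 * z ^ 2 * w ^ 2 → |Q| ≤ x * y * W ^ 2 →
      |4 * F * Q| ≤ 8 * W ^ 4 * (a * u * b * v) := by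
    intro F Q x y z w hx hy hzw hxyzw hF hQ
    rw [abs_mul, abs_mul, abs_of_nonneg (by norm_num : (0 : ℝ) ≤ 4)]
    calc 4 * |F| * |Q| ≤ 4 * (2 * z ^ 2 * w ^ 2) * (x * y * W ^ 2) := by gcongr
      _ = 8 * W ^ 2 * (x * y * (z * w)) * (z * w) := by ring
      _ = 8 * W ^ 2 * (a * u * b * v) * (z * w) := by rw [hxyzw]
      _ ≤ 8 * W ^ 2 * (a * u * b * v) * W ^ 2 := by gcongr
      _ = _ := by ring
  have e₉ := hQ a0 b0 huv (by ring) p₂₄ q₂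
  have e₁₀ := hQ a0 v0 hub (by ring) p₂₃ q₃
  clear hlin hquad hQ q₁ q₂ q₃ hs₁ hs₂ hs₃ m₁₂ m₃₄ m₁₃ m₂₄ m₁₄ m₂₃ p₁₂ p₃₄ p₁₃ p₂₄ p₁₄ p₂₃
  rw [abs_le] at *
  constructor <;> linarith

/-- The size of `preT`, without any use of resonance. -/
theorem abs_preT_le_of_le {k₁ k₂ k₃ k₄ : WaveVec d} {W : ℝ} (h₁ : omega k₁ ≤ W)
    (h₂ : omega k₂ ≤ W) (h₃ : omega k₃ ≤ W) (h₄ : omega k₄ ≤ W) :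
    |preT k₁ k₂ k₃ k₄| ≤ 120 * W ^ 6 := by
  have hW := (omega_nonneg k₁).trans h₁
  refine abs_preT_le (by positivity) ((abs_brace_le h₁ h₂ h₃ h₄).trans ?_)
  have a0 := omega_nonneg k₁
  have u0 := omega_nonneg k₂
  have b0 := omega_nonneg k₃
  have v0 := omega_nonneg k₄
  have hN : 0 ≤ omega k₁ * omega k₂ * omega k₃ * omega k₄ := by positivity
  have hs : √(omega k₁ * omega k₂ * omega k₃ * omega k₄) ≤ W ^ 2 := by
    refine Real.sqrt_le_iff.2 ⟨by positivity, ?_⟩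
    calc omega k₁ * omega k₂ * omega k₃ * omega k₄ ≤ W * W * W * W := by gcongr
      _ = _ := by ring
  have hsq := Real.mul_self_sqrt hN
  have hs0 := Real.sqrt_nonneg (omega k₁ * omega k₂ * omega k₃ * omega k₄)
  nth_rewrite 1 [← hsq]
  calc _ ≤ 120 * W ^ 4 * (√(omega k₁ * omega k₂ * omega k₃ * omega k₄) * W ^ 2) := by gcongr
    _ = _ := by ring

theorem sub_eq_neg_sub_of_add_eq_add {x y z w : WaveVec d} (h : x + y = z + w) :
    y - z = -(x - w) := by
  rw [neg_sub, sub_eq_sub_iff_add_eq_add, add_comm y, h, add_comm]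

/-- On the resonant manifold the brace is symmetric in its lower arguments. -/
theorem brace_swap {k₁ k₂ k₃ k₄ : WaveVec d} (h : k₁ + k₂ = k₃ + k₄)
    (hω : omega k₁ + omega k₂ = omega k₃ + omega k₄) :
    brace k₂ k₁ k₃ k₄ = brace k₁ k₂ k₃ k₄ := by
  have e₁ : omega k₂ - omega k₃ = -(omega k₁ - omega k₄) := by linarith
  have e₂ : omega k₂ - omega k₄ = -(omega k₁ - omega k₃) := by linarith
  have n₁ : omega (k₂ - k₃) = omega (k₁ - k₄) := by
    unfold omega
    rw [sub_eq_neg_sub_of_add_eq_add h, norm_neg]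
  have n₂ : omega (k₂ - k₄) = omega (k₁ - k₃) := by
    unfold omega
    rw [sub_eq_neg_sub_of_add_eq_add (h.trans (add_comm _ _)), norm_neg]
  unfold brace
  rw [e₁, e₂, n₁, n₂, add_comm k₂ k₁, fMinus_comm k₂ k₁, fPlus_comm k₂ k₁]
  ring

/-- On the resonant manifold the brace is symmetric under exchange of lower and upper arguments. -/
theorem brace_exchange {k₁ k₂ k₃ k₄ : WaveVec d} (h : k₁ + k₂ = k₃ + k₄)
    (hω : omega k₁ + omega k₂ = omega k₃ + omega k₄) :
    brace k₃ k₄ k₁ k₂ = brace k₁ k₂ k₃ k₄ := by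
  have e₁ : omega k₃ - omega k₂ = omega k₁ - omega k₄ := by linarith
  have e₂ : omega k₃ - omega k₁ = -(omega k₁ - omega k₃) := by linarith
  have n₁ : k₃ - k₂ = k₁ - k₄ := by
    rw [← neg_sub, sub_eq_neg_sub_of_add_eq_add h, neg_neg]
  have n₂ : omega (k₃ - k₁) = omega (k₁ - k₃) := by unfold omega; rw [norm_sub_rev]
  unfold brace
  rw [e₁, e₂, n₁, n₂, ← hω, ← h, fMinus_comm k₃ k₁, fMinus_comm k₄ k₂, fMinus_comm k₃ k₂,
    fMinus_comm k₄ k₁, fPlus_comm k₃ k₁, fPlus_comm k₄ k₂, fPlus_comm k₃ k₂, fPlus_comm k₄ k₁]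
  ring

theorem preT_swap {k₁ k₂ k₃ k₄ : WaveVec d} (h : k₁ + k₂ = k₃ + k₄)
    (hω : omega k₁ + omega k₂ = omega k₃ + omega k₄) :
    preT k₂ k₁ k₃ k₄ = preT k₁ k₂ k₃ k₄ := by
  rw [preT_eq, preT_eq, brace_swap h hω, mul_comm (omega k₂)]

theorem preT_exchange {k₁ k₂ k₃ k₄ : WaveVec d} (h : k₁ + k₂ = k₃ + k₄)
    (hω : omega k₁ + omega k₂ = omega k₃ + omega k₄) :
    preT k₃ k₄ k₁ k₂ = preT k₁ k₂ k₃ k₄ := by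
  rw [preT_eq, preT_eq, brace_exchange h hω,
    show omega k₃ * omega k₄ * omega k₁ * omega k₂ =
      omega k₁ * omega k₂ * omega k₃ * omega k₄ by ring]

theorem amplitude_eq_preT {k₁ k k₂ k₃ : WaveVec d} (h : k₁ + k = k₂ + k₃)
    (hω : omega k₁ + omega k = omega k₂ + omega k₃) :
    amplitude k₁ k k₂ k₃ = preT k₁ k k₂ k₃ := by
  unfold amplitude
  rw [preT_swap h hω, preT_swap h.symm hω.symm, preT_exchange h hω]
  ring

/-- Comparison of the two small frequencies of a resonant quadruple. -/
theorem nonlocal_compare {a u b v N : ℝ} (ha : 0 ≤ a) (hb : 0 ≤ b) (hv : 0 < v)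
    (hω : a + u = b + v) (hav : 4 * a ≤ v) (hbv : 4 * b ≤ v) (hN : N ≤ a ^ 2 + b ^ 2)
    (huv : |u ^ 2 - v ^ 2| ≤ N) :
    |b - a| * (u + v) ≤ N ∧ 3 * b ≤ 4 * a ∧ 3 * a ≤ 4 * b := by
  have hu : 3 * v ≤ 4 * u := by linarith
  have h1 : |b - a| * (u + v) ≤ N := by
    rwa [show u ^ 2 - v ^ 2 = (b - a) * (u + v) by
      rw [show b - a = u - v by linarith]; ring, abs_mul,
      abs_of_nonneg (by linarith : 0 ≤ u + v)] at huv
  have h2 : 7 * |b - a| ≤ a + b := by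
    have h3 : (7 * |b - a|) * v ≤ (a + b) * v := by
      have := mul_le_mul_of_nonneg_left (by linarith : 7 / 4 * v ≤ u + v) (abs_nonneg (b - a))
      nlinarith
    exact le_of_mul_le_mul_right h3 hv
  have := abs_le.1 (by linarith : |b - a| ≤ (a + b) / 7)
  exact ⟨h1, by linarith, by linarith⟩

theorem nonlocal_defect {a u v α γ I : ℝ} (hα0 : 0 ≤ α) (hα2 : α ≤ 2 * a ^ 2) (hγ0 : 0 ≤ γ)
    (hγ2 : γ ≤ 2 * a ^ 2) (hI : |I| ≤ a ^ 2 * (5 * a ^ 2)) (huv : |u ^ 2 - v ^ 2| ≤ 5 * a ^ 2)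
    (e : (α + γ - 2 * a ^ 2) * v ^ 2 = I + a ^ 2 * (u ^ 2 - v ^ 2) - α * (u ^ 2 - v ^ 2)
        - α * a ^ 2 + α ^ 2 / 2 - γ * a ^ 2 + γ ^ 2 / 2) :
    |α + γ - 2 * a ^ 2| * v ^ 2 ≤ 30 * a ^ 4 := by
  have a2 : 0 ≤ a ^ 2 := by positivity
  have b2 : |a ^ 2 * (u ^ 2 - v ^ 2)| ≤ 5 * a ^ 4 := by
    rw [abs_mul, abs_of_nonneg a2]
    calc a ^ 2 * |u ^ 2 - v ^ 2| ≤ a ^ 2 * (5 * a ^ 2) := by gcongr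
      _ = _ := by ring
  have b3 : |α * (u ^ 2 - v ^ 2)| ≤ 10 * a ^ 4 := by
    rw [abs_mul, abs_of_nonneg hα0]
    calc α * |u ^ 2 - v ^ 2| ≤ (2 * a ^ 2) * (5 * a ^ 2) := by gcongr
      _ = _ := by ring
  have b4 := mul_le_mul_of_nonneg_right hα2 a2
  have b5 := mul_le_mul_of_nonneg_right hγ2 a2
  have b6 := pow_le_pow_left₀ hα0 hα2 2
  have b7 := pow_le_pow_left₀ hγ0 hγ2 2
  have b8 : 0 ≤ α * a ^ 2 := by positivity
  have b9 : 0 ≤ γ * a ^ 2 := by positivity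
  have b10 : 0 ≤ α ^ 2 := by positivity
  have b11 : 0 ≤ γ ^ 2 := by positivity
  have v2 : |v ^ 2| = v ^ 2 := abs_of_nonneg (by positivity)
  rw [← v2, ← abs_mul, e]
  clear e v2 huv
  rw [abs_le] at hI b2 b3 ⊢
  constructor <;> linarith

set_option maxHeartbeats 800000 in
/-- The cancelling part of the brace, for vectors. -/
theorem exists_cancelling_le :
    ∃ C : ℝ, 0 ≤ C ∧ ∀ k₁ k₂ k₃ k₄ : WaveVec d, k₁ + k₂ = k₃ + k₄ →
      omega k₁ + omega k₂ = omega k₃ + omega k₄ → 0 < omega k₁ →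
      4 * omega k₁ ≤ omega k₄ → 4 * omega k₃ ≤ omega k₄ →
      |cancellingPart (omega k₁) (omega k₃) (omega k₂) (omega k₄) (fMinus k₁ k₂) (fMinus k₃ k₄)
        (fPlus k₁ k₄) (fPlus k₂ k₃) (omega (k₁ + k₂) ^ 2 - (omega k₁ + omega k₂) ^ 2)
        (omega (k₁ - k₄) ^ 2 - (omega k₁ - omega k₄) ^ 2)| ≤
          C * (omega k₁ ^ 5 * omega k₄ ^ 3) := by
  obtain ⟨C, hC0, hC⟩ := exists_cancellingPart_le 30
  refine ⟨C, hC0, ?_⟩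
  intro k₁ k₂ k₃ k₄ h hω ha hav hbv
  have hb := omega_nonneg k₃
  have hv : 0 < omega k₄ := by linarith
  have f₁ := fMinus_eq k₁ k₂
  have f₂ := fMinus_eq k₃ k₄
  have g₁ := fPlus_eq k₁ k₄
  have g₂ := fPlus_eq k₂ k₃
  have hS : ‖k₂ - k₃‖ = ‖k₁ - k₄‖ := by
    rw [sub_eq_neg_sub_of_add_eq_add h, norm_neg]
  have hN : ‖k₂ - k₄‖ = ‖k₁ - k₃‖ := by
    rw [sub_eq_neg_sub_of_add_eq_add (h.trans (add_comm _ _)), norm_neg]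
  rw [← h] at f₂
  rw [hS] at g₂
  have hNle : ‖k₁ - k₃‖ ≤ omega k₁ ^ 2 + omega k₃ ^ 2 := by
    rw [omega_sq, omega_sq]; exact norm_sub_le _ _
  have huv : |omega k₂ ^ 2 - omega k₄ ^ 2| ≤ ‖k₁ - k₃‖ := by
    rw [omega_sq, omega_sq, ← hN]; exact abs_norm_sub_norm_le _ _
  have hinner : fPlus k₁ k₄ - fMinus k₁ k₂ =
      inner ℝ k₁ (k₄ - k₂) + omega k₁ ^ 2 * omega k₄ ^ 2 + omega k₁ ^ 2 * omega k₂ ^ 2 := by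
    unfold fPlus fMinus
    rw [omega_sq, omega_sq, omega_sq, inner_sub_right]; ring
  have hinner_le : |inner ℝ k₁ (k₄ - k₂)| ≤ omega k₁ ^ 2 * ‖k₁ - k₃‖ := by
    rw [omega_sq, ← hN, ← norm_sub_rev]; exact abs_real_inner_le_norm _ _
  have hP : ‖k₁ + k₂‖ ≤ omega k₁ ^ 2 + omega k₂ ^ 2 := by
    rw [omega_sq, omega_sq]; exact norm_add_le _ _
  have hP' : omega k₂ ^ 2 - omega k₁ ^ 2 ≤ ‖k₁ + k₂‖ := by
    rw [omega_sq, omega_sq]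
    have := norm_sub_le (k₁ + k₂) k₁
    rw [add_sub_cancel_left] at this
    linarith
  have hSle : ‖k₁ - k₄‖ ≤ omega k₁ ^ 2 + omega k₄ ^ 2 := by
    rw [omega_sq, omega_sq]; exact norm_sub_le _ _
  have hS' : omega k₄ ^ 2 - omega k₁ ^ 2 ≤ ‖k₁ - k₄‖ := by
    rw [omega_sq, omega_sq, norm_sub_rev]; exact norm_sub_norm_le _ _
  rw [omega_sq (k₁ + k₂), omega_sq (k₁ - k₄)]
  clear hN hS
  generalize omega k₁ = a at *
  generalize omega k₂ = u at *
  generalize omega k₃ = b at *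
  generalize omega k₄ = v at *
  generalize inner ℝ k₁ (k₄ - k₂) = I at *
  generalize ‖k₁ - k₃‖ = N at *
  generalize ‖k₁ + k₂‖ = P at *
  generalize ‖k₁ - k₄‖ = S at *
  obtain ⟨α, rfl⟩ : ∃ α, P = a ^ 2 + u ^ 2 - α := ⟨a ^ 2 + u ^ 2 - P, by ring⟩
  obtain ⟨γ, rfl⟩ : ∃ γ, S = a ^ 2 + v ^ 2 - γ := ⟨a ^ 2 + v ^ 2 - S, by ring⟩
  obtain ⟨hθ, hba, hab⟩ := nonlocal_compare ha.le hb hv hω hav hbv hNle huv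
  have hu : 3 * v ≤ 4 * u := by linarith
  have hN5 : N ≤ 5 * a ^ 2 := by nlinarith
  have hα0 : 0 ≤ α := by linarith
  have hα2 : α ≤ 2 * a ^ 2 := by linarith
  have hγ0 : 0 ≤ γ := by linarith
  have hγ2 : γ ≤ 2 * a ^ 2 := by linarith
  have hη : |α + γ - 2 * a ^ 2| * v ^ 2 ≤ 30 * a ^ 4 :=
    nonlocal_defect hα0 hα2 hγ0 hγ2 (hinner_le.trans (by gcongr)) (huv.trans hN5) (by
      rw [f₁, g₁] at hinner
      linear_combination hinner)
  have key := hC a b u v α γ ha (by linarith) hω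
    (by nlinarith [mul_le_mul_of_nonneg_left (by linarith : v ≤ u + v) (abs_nonneg (b - a))])
    (by rw [abs_of_nonneg hα0]; nlinarith) hη (by nlinarith) (by nlinarith)
  refine le_of_eq_of_le ?_ key
  have eu : u = b + v - a := by linarith
  congr 2
  · rw [f₁]; ring
  · rw [f₂, eu]; ring
  · rw [g₁]; ring
  · rw [g₂, eu]; ring
  · ring
  · ring

set_option maxHeartbeats 800000 in
/-- The terms of the brace that are small because `ω(k₁) - ω(k₃)` and `k₁ - k₃` are. -/
theorem abs_small_terms_le {k₁ k₂ k₃ k₄ : WaveVec d} (h : k₁ + k₂ = k₃ + k₄)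
    (hω : omega k₁ + omega k₂ = omega k₃ + omega k₄) (ha : 0 < omega k₁)
    (hav : 4 * omega k₁ ≤ omega k₄) (hbv : 4 * omega k₃ ≤ omega k₄) :
    |-(2 * (omega k₁ - omega k₃) ^ 2 *
          (omega k₂ * omega k₄ * fPlus k₁ k₃ + omega k₁ * omega k₃ * fPlus k₂ k₄))
      + fMinus k₁ k₃ * fMinus k₂ k₄
      + 4 * (omega k₁ - omega k₃) ^ 2 * fPlus k₁ k₃ * fPlus k₂ k₄ /
          (omega (k₁ - k₃) ^ 2 - (omega k₁ - omega k₃) ^ 2)| ≤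
      5000 * (omega k₁ ^ 5 * omega k₄ ^ 3) := by
  have hb := omega_nonneg k₃
  have hv : 0 < omega k₄ := by linarith
  have hN : ‖k₂ - k₄‖ = ‖k₁ - k₃‖ := by
    rw [sub_eq_neg_sub_of_add_eq_add (h.trans (add_comm _ _)), norm_neg]
  have hNle : ‖k₁ - k₃‖ ≤ omega k₁ ^ 2 + omega k₃ ^ 2 := by
    rw [omega_sq, omega_sq]; exact norm_sub_le _ _
  have huv : |omega k₂ ^ 2 - omega k₄ ^ 2| ≤ ‖k₁ - k₃‖ := by
    rw [omega_sq, omega_sq, ← hN]; exact abs_norm_sub_norm_le _ _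
  have p₁ := abs_fPlus_le k₁ k₃
  have m₁ := abs_fMinus_le k₁ k₃
  have p₂ := abs_fPlus_le k₂ k₄
  have m₂ : |fMinus k₂ k₄| ≤ ‖k₁ - k₃‖ ^ 2 / 2 := by
    have h1 := fPlus_eq k₂ k₄
    have h2 := fPlus_eq_fMinus_add k₂ k₄
    rw [hN] at h1
    rw [abs_of_nonpos (fMinus_nonpos _ _)]
    nlinarith [sq_nonneg (omega k₂ ^ 2 - omega k₄ ^ 2)]
  have hN0 := norm_nonneg (k₁ - k₃)
  rw [omega_sq (k₁ - k₃), show ∀ s f g D : ℝ, 4 * s * f * g / D = 4 * g * (s * f / D) by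
    intros; ring]
  clear hN
  generalize omega k₁ = a at *
  generalize omega k₂ = u at *
  generalize omega k₃ = b at *
  generalize omega k₄ = v at *
  generalize ‖k₁ - k₃‖ = N at *
  generalize fPlus k₁ k₃ = F at *
  generalize fPlus k₂ k₄ = G at *
  obtain ⟨hθ, hba, hab⟩ := nonlocal_compare ha.le hb hv hω hav hbv hNle huv
  have hu : 3 * v ≤ 4 * u := by linarith
  have hu' : 4 * u ≤ 5 * v := by linarith
  have hb2 : b ≤ 2 * a := by linarith
  have hN5 : N ≤ 5 * a ^ 2 := by nlinarith
  have hθ2 : (a - b) ^ 2 * (u + v) ^ 2 ≤ N ^ 2 := by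
    rw [show (a - b) ^ 2 * (u + v) ^ 2 = (|b - a| * (u + v)) ^ 2 by
      rw [mul_pow, sq_abs]; ring]
    exact pow_le_pow_left₀ (mul_nonneg (abs_nonneg _) (by linarith)) hθ 2
  have huv3 : 3 * v ^ 2 ≤ (u + v) ^ 2 := by nlinarith
  have hN2 : N ^ 2 ≤ 5 * a ^ 2 * N := by nlinarith
  have hθv : 3 * ((a - b) ^ 2 * v ^ 2) ≤ 5 * a ^ 2 * N := by nlinarith [sq_nonneg (a - b)]
  have hθv' : (a - b) ^ 2 * v ^ 2 ≤ 25 * a ^ 4 := by nlinarith [sq_nonneg a]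
  have hF : |F| ≤ 8 * a ^ 4 := p₁.trans (by
    calc 2 * a ^ 2 * b ^ 2 ≤ 2 * a ^ 2 * (2 * a) ^ 2 := by gcongr
      _ = _ := by ring)
  have hM : |fMinus k₁ k₃| ≤ 8 * a ^ 4 := m₁.trans (by
    calc 2 * a ^ 2 * b ^ 2 ≤ 2 * a ^ 2 * (2 * a) ^ 2 := by gcongr
      _ = _ := by ring)
  have hG : |G| ≤ 8 * v ^ 4 := p₂.trans (by
    calc 2 * u ^ 2 * v ^ 2 ≤ 2 * (2 * v) ^ 2 * v ^ 2 := by gcongr <;> linarith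
      _ = _ := by ring)
  have h8 : a ^ 8 ≤ a ^ 5 * v ^ 3 := by
    calc a ^ 8 = a ^ 5 * a ^ 3 := by ring
      _ ≤ _ := by gcongr; linarith
  have h6 : a ^ 6 * v ^ 2 ≤ a ^ 5 * v ^ 3 := by
    calc a ^ 6 * v ^ 2 = a ^ 5 * v ^ 2 * a := by ring
      _ ≤ a ^ 5 * v ^ 2 * v := by gcongr; linarith
      _ = _ := by ring
  have hD : N ≤ 2 * (N - (a - b) ^ 2) := by
    have h1 : (2 * (a - b) ^ 2) * v ^ 2 ≤ N * v ^ 2 := by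
      have : 16 * a ^ 2 ≤ v ^ 2 := by nlinarith
      nlinarith
    have := le_of_mul_le_mul_right h1 (by positivity)
    linarith
  have hq : |(a - b) ^ 2 * F / (N - (a - b) ^ 2)| * v ^ 2 ≤ 80 * a ^ 6 := by
    have hD0 : 0 ≤ N - (a - b) ^ 2 := by linarith
    rw [abs_div, abs_mul, abs_of_nonneg hD0, abs_of_nonneg (sq_nonneg (a - b)), div_mul_eq_mul_div]
    refine div_le_of_le_mul₀ hD0 (by positivity) ?_
    calc (a - b) ^ 2 * |F| * v ^ 2 = ((a - b) ^ 2 * v ^ 2) * |F| := by ring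
      _ ≤ (5 * a ^ 2 * N) * (8 * a ^ 4) := by
          refine mul_le_mul ?_ hF (abs_nonneg F) (by positivity)
          linarith [mul_nonneg (sq_nonneg (a - b)) (sq_nonneg v)]
      _ = 40 * a ^ 6 * N := by ring
      _ ≤ 40 * a ^ 6 * (2 * (N - (a - b) ^ 2)) := by gcongr
      _ = _ := by ring
  have t₁ : |2 * (a - b) ^ 2 * (u * v * F + a * b * G)| ≤ 1600 * (a ^ 5 * v ^ 3) := by
    have hsum : |u * v * F + a * b * G| ≤ 16 * a ^ 4 * v ^ 2 + 16 * a ^ 2 * v ^ 4 := by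
      refine (abs_add_le _ _).trans ?_
      rw [abs_mul, abs_mul (a * b), abs_of_nonneg (by nlinarith : 0 ≤ u * v),
        abs_of_nonneg (by positivity : 0 ≤ a * b)]
      calc u * v * |F| + a * b * |G|
          ≤ 2 * v * v * (8 * a ^ 4) + a * (2 * a) * (8 * v ^ 4) := by gcongr; linarith
        _ = _ := by ring
    rw [abs_mul, abs_mul, abs_two, abs_of_nonneg (sq_nonneg (a - b))]
    calc 2 * (a - b) ^ 2 * |u * v * F + a * b * G|
        ≤ 2 * (a - b) ^ 2 * (16 * a ^ 4 * v ^ 2 + 16 * a ^ 2 * v ^ 4) := by gcongr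
      _ = 32 * ((a - b) ^ 2 * v ^ 2) * (a ^ 4 + a ^ 2 * v ^ 2) := by ring
      _ ≤ 32 * (25 * a ^ 4) * (a ^ 4 + a ^ 2 * v ^ 2) := by gcongr
      _ = 800 * a ^ 8 + 800 * (a ^ 6 * v ^ 2) := by ring
      _ ≤ _ := by linarith
  have t₂ : |fMinus k₁ k₃ * fMinus k₂ k₄| ≤ 100 * (a ^ 5 * v ^ 3) := by
    rw [abs_mul]
    calc |fMinus k₁ k₃| * |fMinus k₂ k₄| ≤ (8 * a ^ 4) * ((5 * a ^ 2) ^ 2 / 2) := by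
          gcongr
          exact m₂.trans (by gcongr)
      _ = 100 * a ^ 8 := by ring
      _ ≤ _ := by linarith
  have t₃ : |4 * G * ((a - b) ^ 2 * F / (N - (a - b) ^ 2))| ≤ 1280 * 2 * (a ^ 5 * v ^ 3) := by
    rw [abs_mul, abs_mul, abs_of_nonneg (by norm_num : (0 : ℝ) ≤ 4)]
    calc 4 * |G| * |(a - b) ^ 2 * F / (N - (a - b) ^ 2)|
        ≤ 4 * (8 * v ^ 4) * |(a - b) ^ 2 * F / (N - (a - b) ^ 2)| := by gcongr
      _ = 32 * v ^ 2 * (|(a - b) ^ 2 * F / (N - (a - b) ^ 2)| * v ^ 2) := by ring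
      _ ≤ 32 * v ^ 2 * (80 * a ^ 6) := by gcongr
      _ = 2560 * (a ^ 6 * v ^ 2) := by ring
      _ ≤ _ := by linarith
  have h0 : 0 ≤ a ^ 5 * v ^ 3 := by positivity
  refine (abs_add_le _ _).trans ((add_le_add_left (abs_add_le _ _) _).trans ?_)
  rw [abs_neg]
  linarith

/-- The brace in the non-local regime. -/
theorem exists_abs_brace_le :
    ∃ C : ℝ, 0 ≤ C ∧ ∀ k₁ k₂ k₃ k₄ : WaveVec d, k₁ + k₂ = k₃ + k₄ →
      omega k₁ + omega k₂ = omega k₃ + omega k₄ → 0 < omega k₁ →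
      4 * omega k₁ ≤ omega k₄ → 4 * omega k₃ ≤ omega k₄ →
      |brace k₁ k₂ k₃ k₄| ≤ C * (omega k₁ ^ 5 * omega k₄ ^ 3) := by
  obtain ⟨C, hC0, hC⟩ := exists_cancelling_le (d := d)
  refine ⟨C + 5000, by positivity, ?_⟩
  intro k₁ k₂ k₃ k₄ h hω ha hav hbv
  have h₁ := hC k₁ k₂ k₃ k₄ h hω ha hav hbv
  have h₂ := abs_small_terms_le h hω ha hav hbv
  refine (le_of_eq (congrArg abs ?_)).trans
    ((abs_add_le _ _).trans ((add_le_add h₁ h₂).trans_eq (add_mul _ _ _).symm))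
  have q₁ := fPlus_eq_fMinus_add k₁ k₂
  have q₂ := fPlus_eq_fMinus_add k₃ k₄
  have q₃ := fPlus_eq_fMinus_add k₁ k₄
  have q₄ := fPlus_eq_fMinus_add k₂ k₃
  unfold brace cancellingPart
  rw [q₁, q₂, show fMinus k₁ k₄ = fPlus k₁ k₄ - 2 * omega k₁ ^ 2 * omega k₄ ^ 2 by linarith,
    show fMinus k₂ k₃ = fPlus k₂ k₃ - 2 * omega k₂ ^ 2 * omega k₃ ^ 2 by linarith,
    ← omega_sq k₁, ← omega_sq k₂, ← omega_sq k₃, ← omega_sq k₄]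
  ring

/-- The bound for `preT` in the non-local regime, with `r` below all frequencies. -/
theorem exists_abs_preT_le :
    ∃ C : ℝ, 0 ≤ C ∧ ∀ k₁ k₂ k₃ k₄ : WaveVec d, k₁ + k₂ = k₃ + k₄ →
      omega k₁ + omega k₂ = omega k₃ + omega k₄ →
      4 * omega k₁ ≤ omega k₄ → 4 * omega k₃ ≤ omega k₄ →
      ∃ r : ℝ, 0 ≤ r ∧ r ≤ omega k₁ ∧ r ≤ omega k₂ ∧ r ≤ omega k₃ ∧ r ≤ omega k₄ ∧
        |preT k₁ k₂ k₃ k₄| ≤ C * r ^ 4 * omega k₄ ^ 2 := by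
  obtain ⟨C, hC0, hC⟩ := exists_abs_brace_le (d := d)
  refine ⟨32 * C, by positivity, ?_⟩
  intro k₁ k₂ k₃ k₄ h hω hav hbv
  rcases (omega_nonneg k₁).eq_or_lt with ha | ha
  · refine ⟨0, le_rfl, omega_nonneg _, omega_nonneg _, omega_nonneg _, omega_nonneg _, ?_⟩
    rw [preT_eq, ← ha]
    simp
  have hb := omega_nonneg k₃
  have hv : 0 < omega k₄ := by linarith
  have hNle : ‖k₁ - k₃‖ ≤ omega k₁ ^ 2 + omega k₃ ^ 2 := by
    rw [omega_sq, omega_sq]; exact norm_sub_le _ _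
  have huv : |omega k₂ ^ 2 - omega k₄ ^ 2| ≤ ‖k₁ - k₃‖ := by
    rw [omega_sq, omega_sq, ← norm_neg (k₁ - k₃),
      ← sub_eq_neg_sub_of_add_eq_add (h.trans (add_comm _ _))]
    exact abs_norm_sub_norm_le _ _
  have hu := omega_nonneg k₂
  obtain ⟨-, hba, hab⟩ := nonlocal_compare ha.le hb hv hω hav hbv hNle huv
  refine ⟨omega k₁ / 2, by linarith, by linarith, by linarith, by linarith, by linarith, ?_⟩
  have hbr := hC k₁ k₂ k₃ k₄ h hω ha hav hbv
  refine abs_preT_le (by positivity) (hbr.trans ?_)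
  have hsqrt : omega k₁ * omega k₄ / 2 ≤ √(omega k₁ * omega k₂ * omega k₃ * omega k₄) := by
    refine Real.le_sqrt_of_sq_le ?_
    calc (omega k₁ * omega k₄ / 2) ^ 2
        = omega k₁ * (omega k₄ / 2) * (omega k₁ / 2) * omega k₄ := by ring
      _ ≤ _ := by gcongr <;> linarith
  calc C * (omega k₁ ^ 5 * omega k₄ ^ 3)
      = 32 * C * (omega k₁ / 2) ^ 4 * omega k₄ ^ 2 * (omega k₁ * omega k₄ / 2) := by ring
    _ ≤ _ := by gcongr

theorem minPair_le (K : Fin 4 → WaveVec d) {i j : Fin 4} (h : i < j) :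
    minPair K ≤ ‖K i‖ ^ 2 + ‖K j‖ ^ 2 := by
  unfold minPair
  exact Finset.inf'_le (fun p : Fin 4 × Fin 4 => ‖K p.1‖ ^ 2 + ‖K p.2‖ ^ 2)
    (b := (i, j)) (by simp [h])

theorem le_minPair (K : Fin 4 → WaveVec d) {s : ℝ}
    (h : ∀ i j, i < j → s ≤ ‖K i‖ ^ 2 + ‖K j‖ ^ 2) : s ≤ minPair K := by
  unfold minPair
  refine Finset.le_inf' _ _ ?_
  rintro ⟨i, j⟩ hij
  exact h i j (by simpa using hij)

theorem pow_four_le_minPair (K : Fin 4 → WaveVec d) {r : ℝ} (hr : 0 ≤ r)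
    (h : ∀ i, r ≤ omega (K i)) : r ^ 4 ≤ minPair K := by
  refine le_minPair K fun i j _ => ?_
  have := pow_le_pow_left₀ hr (h i) 4
  rw [show omega (K i) ^ 4 = ‖K i‖ ^ 2 by rw [← omega_sq]; ring] at this
  nlinarith [sq_nonneg ‖K j‖]

/-- The bound for `preT` when one lower and one upper frequency are small, `r` being a lower bound
for all frequencies and `W` an upper bound for the other two. -/
theorem exists_abs_preT_le_of_small :
    ∃ C : ℝ, 0 ≤ C ∧ ∀ (k₁ k₂ k₃ k₄ : WaveVec d) (W : ℝ), k₁ + k₂ = k₃ + k₄ →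
      omega k₁ + omega k₂ = omega k₃ + omega k₄ →
      (omega k₁ = W ∨ omega k₂ = W ∨ omega k₃ = W ∨ omega k₄ = W) → omega k₄ ≤ W →
      5 * omega k₁ ≤ W → 5 * omega k₃ ≤ W →
      ∃ r : ℝ, 0 ≤ r ∧ r ≤ omega k₁ ∧ r ≤ omega k₂ ∧ r ≤ omega k₃ ∧ r ≤ omega k₄ ∧
        |preT k₁ k₂ k₃ k₄| ≤ C * r ^ 4 * W ^ 2 := by
  obtain ⟨C, hC0, hC⟩ := exists_abs_preT_le (d := d)
  refine ⟨C, hC0, ?_⟩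
  intro k₁ k₂ k₃ k₄ W h hω hmax h₄ h₁ h₃
  have a0 := omega_nonneg k₁
  have u0 := omega_nonneg k₂
  have b0 := omega_nonneg k₃
  have v0 := omega_nonneg k₄
  have hv : 4 * W ≤ 5 * omega k₄ := by
    rcases hmax with h' | h' | h' | h' <;> linarith
  obtain ⟨r, hr, r₁, r₂, r₃, r₄, hT⟩ := hC k₁ k₂ k₃ k₄ h hω (by linarith) (by linarith)
  exact ⟨r, hr, r₁, r₂, r₃, r₄, hT.trans (by gcongr)⟩

/-- The amplitude on the resonant manifold. -/
theorem exists_abs_amplitude_le :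
    ∃ C : ℝ, 0 ≤ C ∧ ∀ K : Fin 4 → WaveVec d, Resonant K →
      ∃ j, |amplitude (K 1) (K 0) (K 2) (K 3)| ≤ C * minPair K * ‖K j‖ := by
  obtain ⟨C, hC0, hC⟩ := exists_abs_preT_le_of_small (d := d)
  refine ⟨C + 75000, by positivity, ?_⟩
  rintro K ⟨hk, hω⟩
  obtain ⟨j, hj⟩ := Finite.exists_max fun i => omega (K i)
  refine ⟨j, ?_⟩
  have hk' : K 1 + K 0 = K 2 + K 3 := by
    rw [add_comm, ← sub_eq_zero, ← hk]; abel
  have hω' : omega (K 1) + omega (K 0) = omega (K 2) + omega (K 3) := by linarith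
  have h0 := omega_nonneg (K 0)
  have h1 := omega_nonneg (K 1)
  have h2 := omega_nonneg (K 2)
  have h3 := omega_nonneg (K 3)
  have hmax : omega (K 0) = omega (K j) ∨ omega (K 1) = omega (K j) ∨
      omega (K 2) = omega (K j) ∨ omega (K 3) = omega (K j) := by
    fin_cases j <;> simp
  rw [amplitude_eq_preT hk' hω', ← omega_sq (K j)]
  have hW := omega_nonneg (K j)
  have hm0 : 0 ≤ minPair K := le_minPair K fun i j _ => by positivity
  have small : ∀ r : ℝ, 0 ≤ r → r ≤ omega (K 0) → r ≤ omega (K 1) → r ≤ omega (K 2) →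
      r ≤ omega (K 3) → |preT (K 1) (K 0) (K 2) (K 3)| ≤ C * r ^ 4 * omega (K j) ^ 2 →
      |preT (K 1) (K 0) (K 2) (K 3)| ≤ (C + 75000) * minPair K * omega (K j) ^ 2 := by
    intro r hr r0 r1 r2 r3 hT
    have hm : r ^ 4 ≤ minPair K := pow_four_le_minPair K hr (by
      intro i; fin_cases i <;> assumption)
    refine hT.trans ?_
    gcongr
    linarith
  have s₁ : preT (K 0) (K 1) (K 2) (K 3) = preT (K 1) (K 0) (K 2) (K 3) := preT_swap hk' hω'
  have s₂ : preT (K 1) (K 0) (K 3) (K 2) = preT (K 1) (K 0) (K 2) (K 3) := by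
    rw [← preT_exchange hk' hω', ← preT_swap hk'.symm hω'.symm,
      preT_exchange (hk'.trans (add_comm _ _)) (hω'.trans (add_comm _ _))]
  have s₃ : preT (K 0) (K 1) (K 3) (K 2) = preT (K 1) (K 0) (K 2) (K 3) := by
    rw [preT_swap (hk'.trans (add_comm _ _)) (hω'.trans (add_comm _ _)), s₂]
  by_cases c₁₂ : 5 * omega (K 1) ≤ omega (K j) ∧ 5 * omega (K 2) ≤ omega (K j)
  · obtain ⟨r, hr, r₁, r₂, r₃, r₄, hT⟩ := hC (K 1) (K 0) (K 2) (K 3) (omega (K j)) hk' hω'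
      (by tauto) (hj 3) c₁₂.1 c₁₂.2
    exact small r hr r₂ r₁ r₃ r₄ hT
  by_cases c₀₂ : 5 * omega (K 0) ≤ omega (K j) ∧ 5 * omega (K 2) ≤ omega (K j)
  · obtain ⟨r, hr, r₁, r₂, r₃, r₄, hT⟩ := hC (K 0) (K 1) (K 2) (K 3) (omega (K j))
      ((add_comm _ _).trans hk') ((add_comm _ _).trans hω') (by tauto) (hj 3) c₀₂.1 c₀₂.2
    exact small r hr r₁ r₂ r₃ r₄ (s₁ ▸ hT)
  by_cases c₁₃ : 5 * omega (K 1) ≤ omega (K j) ∧ 5 * omega (K 3) ≤ omega (K j)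
  · obtain ⟨r, hr, r₁, r₂, r₃, r₄, hT⟩ := hC (K 1) (K 0) (K 3) (K 2) (omega (K j))
      (hk'.trans (add_comm _ _)) (hω'.trans (add_comm _ _)) (by tauto) (hj 2) c₁₃.1 c₁₃.2
    exact small r hr r₂ r₁ r₄ r₃ (s₂ ▸ hT)
  by_cases c₀₃ : 5 * omega (K 0) ≤ omega (K j) ∧ 5 * omega (K 3) ≤ omega (K j)
  · obtain ⟨r, hr, r₁, r₂, r₃, r₄, hT⟩ := hC (K 0) (K 1) (K 3) (K 2) (omega (K j))
      (((add_comm _ _).trans hk').trans (add_comm _ _))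
      (((add_comm _ _).trans hω').trans (add_comm _ _)) (by tauto) (hj 2) c₀₃.1 c₀₃.2
    exact small r hr r₁ r₂ r₄ r₃ (s₃ ▸ hT)
  have large : ∀ i, omega (K j) ≤ 5 * omega (K i) → (omega (K j) / 5) ^ 4 ≤ ‖K i‖ ^ 2 := by
    intro i hi
    rw [← omega_sq]
    calc (omega (K j) / 5) ^ 4 ≤ omega (K i) ^ 4 := by gcongr; linarith
      _ = _ := by ring
  have hm : (omega (K j) / 5) ^ 4 ≤ minPair K := by
    refine le_minPair K fun i l hil => ?_
    have hor : omega (K j) ≤ 5 * omega (K i) ∨ omega (K j) ≤ 5 * omega (K l) := by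
      by_contra! hcon
      obtain ⟨hi, hl⟩ := hcon
      fin_cases i <;> fin_cases l <;> simp at hil hi hl
      · rcases hmax with h | h | h | h <;> linarith
      · exact c₀₂ ⟨hi.le, hl.le⟩
      · exact c₀₃ ⟨hi.le, hl.le⟩
      · exact c₁₂ ⟨hi.le, hl.le⟩
      · exact c₁₃ ⟨hi.le, hl.le⟩
      · rcases hmax with h | h | h | h <;> linarith
    rcases hor with h | h
    · linarith [large i h, sq_nonneg ‖K l‖]
    · linarith [large l h, sq_nonneg ‖K i‖]
  refine (abs_preT_le_of_le (hj 1) (hj 0) (hj 2) (hj 3)).trans ?_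
  calc 120 * omega (K j) ^ 6 = 75000 * (omega (K j) / 5) ^ 4 * omega (K j) ^ 2 := by ring
    _ ≤ (C + 75000) * minPair K * omega (K j) ^ 2 := by gcongr; linarith

end GravityWave

theorem proposition2p1 (d : ℕ) (hd : 2 ≤ d) :
    ∃ C : ℝ, 0 < C ∧ ∀ K : Fin 4 → WaveVec d, GravityWave.Resonant K →
      GravityWave.kernel (K 0) (K 1) (K 2) (K 3)
          ≤ C * GravityWave.minPair K ^ 2 * ∑ j : Fin 4, ‖K j‖ ^ 2 ∧
      (20 * ‖K 1‖ ≤ ‖K 3‖ → 20 * ‖K 2‖ ≤ ‖K 3‖ →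
        |GravityWave.amplitude (K 1) (K 0) (K 2) (K 3)|
            ≤ C * (‖K 1‖ ^ 2 + ‖K 2‖ ^ 2) * ‖K 0‖ ∧
        GravityWave.kernel (K 0) (K 1) (K 2) (K 3)
            ≤ C * (‖K 1‖ ^ 2 + ‖K 2‖ ^ 2) ^ 2 * (‖K 0‖ * ‖K 3‖)) := by
  obtain ⟨C, hC0, hC⟩ := GravityWave.exists_abs_amplitude_le (d := d)
  refine ⟨4 * C ^ 2 + 2 * C + 1, by positivity, ?_⟩
  intro K hK
  obtain ⟨j, hT⟩ := hC K hK
  have hm0 : 0 ≤ GravityWave.minPair K := GravityWave.le_minPair K fun i j _ => by positivity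
  have hker : GravityWave.kernel (K 0) (K 1) (K 2) (K 3) ≤
      C ^ 2 * GravityWave.minPair K ^ 2 * ‖K j‖ ^ 2 := by
    unfold GravityWave.kernel
    calc _ ≤ (C * GravityWave.minPair K * ‖K j‖) ^ 2 := by gcongr
      _ = _ := by ring
  refine ⟨hker.trans ?_, fun h1 h2 => ?_⟩
  · have hj : ‖K j‖ ^ 2 ≤ ∑ i : Fin 4, ‖K i‖ ^ 2 :=
      Finset.single_le_sum (f := fun i => ‖K i‖ ^ 2) (fun i _ => sq_nonneg _) (Finset.mem_univ j)
    gcongr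
    nlinarith
  · have hm := GravityWave.minPair_le K (show (1 : Fin 4) < 2 by decide)
    have n0 := norm_nonneg (K 0)
    have n1 := norm_nonneg (K 1)
    have n2 := norm_nonneg (K 2)
    have n3 := norm_nonneg (K 3)
    have e : K 0 + K 1 - K 2 = K 3 := sub_eq_zero.1 hK.1
    have e' : K 3 + K 2 - K 1 = K 0 := by rw [← e]; abel
    have u3 : ‖K 3‖ ≤ ‖K 0‖ + ‖K 1‖ + ‖K 2‖ := by
      rw [← e]; exact (norm_sub_le _ _).trans (by gcongr; exact norm_add_le _ _)
    have u0 : ‖K 0‖ ≤ ‖K 3‖ + ‖K 2‖ + ‖K 1‖ := by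
      rw [← e']; exact (norm_sub_le _ _).trans (by gcongr; exact norm_add_le _ _)
    have hj0 : ‖K j‖ ≤ 2 * ‖K 0‖ := by fin_cases j <;> simp <;> linarith
    have hj3 : ‖K j‖ ≤ 2 * ‖K 3‖ := by fin_cases j <;> simp <;> linarith
    constructor
    · calc _ ≤ C * GravityWave.minPair K * ‖K j‖ := hT
        _ ≤ C * (‖K 1‖ ^ 2 + ‖K 2‖ ^ 2) * (2 * ‖K 0‖) := by gcongr
        _ = (2 * C) * (‖K 1‖ ^ 2 + ‖K 2‖ ^ 2) * ‖K 0‖ := by ring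
        _ ≤ _ := by gcongr; nlinarith
    · calc _ ≤ C ^ 2 * GravityWave.minPair K ^ 2 * ‖K j‖ ^ 2 := hker
        _ = C ^ 2 * GravityWave.minPair K ^ 2 * (‖K j‖ * ‖K j‖) := by ring
        _ ≤ C ^ 2 * (‖K 1‖ ^ 2 + ‖K 2‖ ^ 2) ^ 2 * ((2 * ‖K 0‖) * (2 * ‖K 3‖)) := by gcongr
        _ = (4 * C ^ 2) * (‖K 1‖ ^ 2 + ‖K 2‖ ^ 2) ^ 2 * (‖K 0‖ * ‖K 3‖) := by ring
        _ ≤ _ := by gcongr; nlinarith
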